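/- Let $k, N \ge 3$ and let $\phi : SO(k) \to SO(N)$ be a representation, i.e. a continuous group homomorphism (equivalently, a homomorphism of Lie groups). For $\sigma \in S_N$ let $E_\sigma$ be the corresponding $N\times N$ permutation matrix. Assume that $\mathbb{R}^N$ has no one-dimensional linear subspace invariant under $\phi(g)$ for all $g \in SO(k)$. Then the subgroup of $SO(N)$ generated by the elements $E_\sigma^{-1}\phi(g)E_\sigma$, with $\sigma \in S_N$ and $g \in SO(k)$, is all of $SO(N)$. Moreover, for every permutation $\sigma_0 \in S_N$ of sign $-1$, the subgroup of $O(N)$ generated by $E_{\sigma_0}$ together with all the elements $E_\sigma^{-1}\phi(g)E_\sigma$ ($\sigma \in S_N$, $g \in SO(k)$) is all of $O(N)$. -/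

import Mathlib

open scoped Matrix

namespace PermConj

/-- The permutation matrix `E_σ`, as an element of the orthogonal group `O(N)`. -/
noncomputable def permO {N : ℕ} (σ : Equiv.Perm (Fin N)) :
    Matrix.orthogonalGroup (Fin N) ℝ :=
  ⟨σ.permMatrix ℝ, by
    rw [Matrix.mem_orthogonalGroup_iff, Matrix.transpose_permMatrix, ← Matrix.permMatrix_mul]
    simp⟩

/-- The inclusion homomorphism `SO(N) → O(N)`. -/
def inclO (N : ℕ) :
    Matrix.specialOrthogonalGroup (Fin N) ℝ →* Matrix.orthogonalGroup (Fin N) ℝ :=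
  Submonoid.inclusion Matrix.specialUnitaryGroup_le_unitaryGroup

theorem conj_mem_specialOrthogonalGroup {N : ℕ} (σ : Equiv.Perm (Fin N))
    (A : Matrix.specialOrthogonalGroup (Fin N) ℝ) :
    (((permO σ)⁻¹ * inclO N A * permO σ : Matrix.orthogonalGroup (Fin N) ℝ) :
      Matrix (Fin N) (Fin N) ℝ) ∈ Matrix.specialOrthogonalGroup (Fin N) ℝ := by
  rw [Matrix.mem_specialOrthogonalGroup_iff]
  refine ⟨Subtype.property _, ?_⟩
  have hA : ((inclO N A : Matrix.orthogonalGroup (Fin N) ℝ) :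
      Matrix (Fin N) (Fin N) ℝ).det = 1 :=
    (Matrix.mem_specialOrthogonalGroup_iff.1 A.2).2
  have h1 : (((permO σ)⁻¹ * permO σ : Matrix.orthogonalGroup (Fin N) ℝ) :
      Matrix (Fin N) (Fin N) ℝ).det = 1 := by
    rw [inv_mul_cancel]; simp
  rw [Submonoid.coe_mul, Matrix.det_mul] at h1 ⊢
  rw [Submonoid.coe_mul, Matrix.det_mul, hA, mul_one, h1]

/-- The conjugate `E_σ⁻¹ A E_σ` of `A ∈ SO(N)` by a permutation matrix, as an element of
`SO(N)`. -/
noncomputable def permConj {N : ℕ} (σ : Equiv.Perm (Fin N))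
    (A : Matrix.specialOrthogonalGroup (Fin N) ℝ) :
    Matrix.specialOrthogonalGroup (Fin N) ℝ :=
  ⟨((permO σ)⁻¹ * inclO N A * permO σ : Matrix.orthogonalGroup (Fin N) ℝ),
    conj_mem_specialOrthogonalGroup σ A⟩

/-- A linear subspace `V` of `ℝ^N` is invariant under the representation `φ` of `SO(k)`. -/
def IsInvariant {k N : ℕ}
    (φ : Matrix.specialOrthogonalGroup (Fin k) ℝ →* Matrix.specialOrthogonalGroup (Fin N) ℝ)
    (V : Submodule ℝ (Fin N → ℝ)) : Prop :=
  ∀ g : Matrix.specialOrthogonalGroup (Fin k) ℝ, ∀ v ∈ V,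
    (φ g : Matrix (Fin N) (Fin N) ℝ) *ᵥ v ∈ V

end PermConj

/-!
The span of `1 = (1, …, 1)` is not invariant, so the image of `φ` does not fix this vector.
Let `Γ` be the subgroup of `SO(N)` generated by the conjugates, and let `W` be the linear span of
the matrices `X` with `exp (t • X) ∈ Γ` for all `t` (`expGenerators`). No closedness of `Γ` is
needed: `W` is stable under conjugation by `Γ`, hence, differentiating, under commutators
(`commutator_mem_span_expGenerators`), and it is stable under simultaneous permutations of rows and
columns, because `Γ` is stable under conjugation by permutation matrices.

Some generator `X` has `X 1 ≠ 0`: otherwise the one-parameter groups in `φ(SO(k))` would fix `1`,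
and they generate `φ(SO(k))` (`map_mulVec_one_of_forall_expGenerators`). Averaging `X` over the
stabilizer of an index `i` in the symmetric group gives a nonzero multiple of
`F_i = e_i 1ᵀ - 1 e_iᵀ`; then all `F_j` lie in `W`, and the commutators of these yield every
`e_i e_jᵀ - e_j e_iᵀ`. So `W` consists of all skew-symmetric matrices
(`skew_mem_of_commutator_of_perm`).

Finally, a subgroup whose generators span the skew-symmetric matrices is open, by the surjective
form of the inverse function theorem applied to products of its one-parameter groups
(`eq_top_of_skew_le_span`), and `SO(n)` has no proper open subgroup, since any two hyperplane
reflections are joined by a path of reflections and the reflections generate `O(n)`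
(`eq_top_of_isOpen`). The passage from `SO(N)` to `O(N)` is by determinants.
-/

/-! ### Continuous one-parameter groups -/

/-- A continuous one-parameter group in a real Banach algebra is of the form `t ↦ exp (t • X)`.
The averages of `f` over short intervals are invertible, which makes `f` differentiable. -/
theorem exists_eq_exp_smul_of_continuous {𝔸 : Type*} [NormedRing 𝔸] [NormedAlgebra ℝ 𝔸]
    [CompleteSpace 𝔸] {f : ℝ → 𝔸} (hf : Continuous f) (h0 : f 0 = 1)
    (hadd : ∀ s t, f (s + t) = f s * f t) :
    ∃ X : 𝔸, ∀ t : ℝ, f t = NormedSpace.exp (t • X) := by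
  set F : ℝ → 𝔸 := fun a => ∫ s in (0 : ℝ)..a, f s with hF
  have hFd : ∀ a, HasDerivAt F (f a) a := fun a =>
    intervalIntegral.integral_hasDerivAt_right (hf.intervalIntegrable _ _)
      hf.stronglyMeasurable.stronglyMeasurableAtFilter hf.continuousAt
  have hunit : ∃ a : ℝ, IsUnit (F a) := by
    have h1 : Filter.Tendsto (fun a : ℝ => a⁻¹ • F a) (nhdsWithin 0 {0}ᶜ) (nhds (1 : 𝔸)) := by
      have h := (hasDerivAt_iff_tendsto_slope_zero.1 (hFd 0))
      simpa [hF, h0] using h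
    have h2 : ∀ᶠ a in nhdsWithin (0 : ℝ) {0}ᶜ, IsUnit (a⁻¹ • F a) :=
      h1.eventually (Units.isOpen.mem_nhds isUnit_one)
    obtain ⟨a, ha, ha0⟩ := (h2.and self_mem_nhdsWithin).exists
    have ha0' : a ≠ 0 := ha0
    refine ⟨a, ?_⟩
    have h3 := (IsUnit.smul (Units.mk0 a ha0') ha)
    rwa [Units.smul_mk0, smul_smul, mul_inv_cancel₀ ha0', one_smul] at h3
  obtain ⟨a, u, hu⟩ := hunit
  -- `f t = (F (t + a) - F t) * (F a)⁻¹`, and the right-hand side is differentiable in `t`.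
  have hmul : ∀ t, f t * F a = F (t + a) - F t := by
    intro t
    have h1 : f t * F a = ∫ s in (0 : ℝ)..a, f (t + s) := by
      simp only [hF, hadd]
      exact ((ContinuousLinearMap.mul ℝ 𝔸 (f t)).intervalIntegral_comp_comm
        (hf.intervalIntegrable _ _)).symm
    rw [h1, intervalIntegral.integral_comp_add_left (fun s => f s), add_zero,
      ← intervalIntegral.integral_interval_sub_left (hf.intervalIntegrable _ _)
        (hf.intervalIntegrable _ _)]
  have hfeq : ∀ t, f t = (F (t + a) - F t) * ↑u⁻¹ := by
    intro t
    rw [← hmul, ← hu, mul_assoc, Units.mul_inv, mul_one]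
  set X : 𝔸 := (f a - 1) * ↑u⁻¹ with hX
  have hder : ∀ t, HasDerivAt f (f t * X) t := by
    intro t
    have h1 : HasDerivAt (fun t => (F (t + a) - F t) * ↑u⁻¹)
        ((f (t + a) - f t) * ↑u⁻¹) t :=
      (((hFd (t + a)).comp_add_const t a).sub (hFd t)).mul_const _
    have h2 : (f (t + a) - f t) * (↑u⁻¹ : 𝔸) = f t * X := by
      rw [hX, hadd, ← mul_assoc, mul_sub, mul_one]
    rw [h2] at h1
    exact h1.congr_of_eventuallyEq (Filter.Eventually.of_forall hfeq)
  refine ⟨X, fun t => ?_⟩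
  have hexp : ∀ t : ℝ, HasDerivAt (fun t : ℝ => NormedSpace.exp (t • (-X)))
      (-X * NormedSpace.exp (t • (-X))) t := fun t => hasDerivAt_exp_smul_const' (-X) t
  have hprod : ∀ t, HasDerivAt (fun t : ℝ => f t * NormedSpace.exp (t • (-X))) 0 t := by
    intro t
    have := (hder t).mul (hexp t)
    convert! this using 1
    noncomm_ring
  have hconst : f t * NormedSpace.exp (t • (-X)) = 1 := by
    have h := is_const_of_deriv_eq_zero (fun t => (hprod t).differentiableAt)
      (fun t => (hprod t).deriv) t 0
    simpa [h0] using h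
  have hinv : NormedSpace.exp (t • (-X)) * NormedSpace.exp (t • X) = 1 := by
    let _ : NormedAlgebra ℚ 𝔸 := NormedAlgebra.restrictScalars ℚ ℝ 𝔸
    rw [smul_neg, ← NormedSpace.exp_add_of_commute (Commute.refl (t • X)).neg_left]
    simp
  calc f t = f t * (NormedSpace.exp (t • (-X)) * NormedSpace.exp (t • X)) := by
        rw [hinv, mul_one]
    _ = NormedSpace.exp (t • X) := by rw [← mul_assoc, hconst, one_mul]

/-! ### Connectedness of the special orthogonal group -/

/-- The matrix of the reflection in the hyperplane orthogonal to `u`, for `u` a unit vector. -/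
def reflMatrix {n : ℕ} (u : EuclideanSpace ℝ (Fin n)) : Matrix (Fin n) (Fin n) ℝ :=
  1 - (2 : ℝ) • Matrix.vecMulVec u.ofLp u.ofLp

theorem dotProduct_self_of_norm_eq_one {n : ℕ} {u : EuclideanSpace ℝ (Fin n)} (hu : ‖u‖ = 1) :
    u.ofLp ⬝ᵥ u.ofLp = 1 := by
  have h := real_inner_self_eq_norm_sq u
  rw [hu, EuclideanSpace.inner_eq_star_dotProduct] at h
  simpa using h

theorem reflMatrix_mul_self {n : ℕ} {u : EuclideanSpace ℝ (Fin n)} (hu : ‖u‖ = 1) :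
    reflMatrix u * reflMatrix u = 1 := by
  have h : Matrix.vecMulVec u.ofLp u.ofLp * Matrix.vecMulVec u.ofLp u.ofLp =
      Matrix.vecMulVec u.ofLp u.ofLp := by
    rw [Matrix.vecMulVec_mul_vecMulVec, dotProduct_self_of_norm_eq_one hu]
    simp
  simp only [reflMatrix, mul_sub, sub_mul, mul_one, one_mul, Matrix.smul_mul, Matrix.mul_smul, h]
  module

theorem transpose_reflMatrix {n : ℕ} (u : EuclideanSpace ℝ (Fin n)) :
    (reflMatrix u)ᵀ = reflMatrix u := by
  simp [reflMatrix, Matrix.transpose_vecMulVec]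

theorem det_reflMatrix {n : ℕ} {u : EuclideanSpace ℝ (Fin n)} (hu : ‖u‖ = 1) :
    (reflMatrix u).det = -1 := by
  have h : reflMatrix u = 1 + Matrix.replicateCol Unit ((-2 : ℝ) • u.ofLp) *
      Matrix.replicateRow Unit u.ofLp := by
    rw [← Matrix.vecMulVec_eq, reflMatrix, Matrix.smul_vecMulVec]
    module
  rw [h, Matrix.det_one_add_replicateCol_mul_replicateRow, dotProduct_smul,
    dotProduct_self_of_norm_eq_one hu]
  norm_num

theorem reflMatrix_mul_mem {n : ℕ} {u v : EuclideanSpace ℝ (Fin n)} (hu : ‖u‖ = 1)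
    (hv : ‖v‖ = 1) : reflMatrix u * reflMatrix v ∈ Matrix.specialOrthogonalGroup (Fin n) ℝ := by
  rw [Matrix.mem_specialOrthogonalGroup_iff, Matrix.mem_orthogonalGroup_iff]
  refine ⟨?_, by rw [Matrix.det_mul, det_reflMatrix hu, det_reflMatrix hv]; norm_num⟩
  rw [Matrix.transpose_mul, transpose_reflMatrix, transpose_reflMatrix, mul_assoc,
    ← mul_assoc (reflMatrix v), reflMatrix_mul_self hv, one_mul, reflMatrix_mul_self hu]

theorem toLpLin_reflMatrix {n : ℕ} {u : EuclideanSpace ℝ (Fin n)} (hu : ‖u‖ = 1)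
    (x : EuclideanSpace ℝ (Fin n)) :
    Matrix.toLpLinAlgEquiv 2 (reflMatrix u) x = (ℝ ∙ u)ᗮ.reflection x := by
  rw [Submodule.reflection_orthogonal_apply, Submodule.reflection_singleton_apply, hu,
    EuclideanSpace.inner_eq_star_dotProduct]
  ext i
  simp [reflMatrix, Matrix.vecMulVec_mulVec, dotProduct_comm]
  ring

/-- The product of the reflections in two hyperplanes lies in every open subgroup of `SO(n)`: moving one
unit vector to the other along the (connected) sphere joins the product to the identity. -/
theorem reflMatrix_mul_mem_of_isOpen {n : ℕ} (hn : 2 ≤ n)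
    {H : Subgroup (Matrix.specialOrthogonalGroup (Fin n) ℝ)}
    (hH : IsOpen (H : Set (Matrix.specialOrthogonalGroup (Fin n) ℝ)))
    {u v : EuclideanSpace ℝ (Fin n)} (hu : ‖u‖ = 1) (hv : ‖v‖ = 1) :
    (⟨_, reflMatrix_mul_mem hu hv⟩ : Matrix.specialOrthogonalGroup (Fin n) ℝ) ∈ H := by
  have hrank : 1 < Module.rank ℝ (EuclideanSpace ℝ (Fin n)) := by
    rw [← Module.finrank_eq_rank, finrank_euclideanSpace_fin]
    exact_mod_cast hn
  have : PreconnectedSpace (Metric.sphere (0 : EuclideanSpace ℝ (Fin n)) 1) :=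
    Subtype.preconnectedSpace (isPreconnected_sphere hrank 0 1)
  have hs : ∀ w : Metric.sphere (0 : EuclideanSpace ℝ (Fin n)) 1,
      ‖(w : EuclideanSpace ℝ (Fin n))‖ = 1 := fun w => by simp
  let p : Metric.sphere (0 : EuclideanSpace ℝ (Fin n)) 1 →
      Matrix.specialOrthogonalGroup (Fin n) ℝ := fun w => ⟨_, reflMatrix_mul_mem (hs w) hv⟩
  have hp : Continuous p := by
    refine Continuous.subtype_mk ?_ _
    unfold reflMatrix
    fun_prop
  have hclopen : IsClopen (p ⁻¹' (H : Set (Matrix.specialOrthogonalGroup (Fin n) ℝ))) :=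
    IsClopen.preimage ⟨H.isClosed_of_isOpen hH, hH⟩ hp
  have hne : (p ⁻¹' (H : Set (Matrix.specialOrthogonalGroup (Fin n) ℝ))).Nonempty := by
    refine ⟨⟨v, by simpa using hv⟩, ?_⟩
    have : p ⟨v, by simpa using hv⟩ = 1 := Subtype.ext (reflMatrix_mul_self hv)
    rw [Set.mem_preimage, this]
    exact H.one_mem
  have huniv := hclopen.eq_univ hne
  have hmem : (⟨u, by simpa using hu⟩ : Metric.sphere (0 : EuclideanSpace ℝ (Fin n)) 1) ∈
      p ⁻¹' (H : Set (Matrix.specialOrthogonalGroup (Fin n) ℝ)) := huniv ▸ Set.mem_univ _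
  exact hmem

theorem exists_norm_eq_one_span_eq {n : ℕ} {v : EuclideanSpace ℝ (Fin n)} (hv : v ≠ 0) :
    ∃ u : EuclideanSpace ℝ (Fin n), ‖u‖ = 1 ∧ (ℝ ∙ v) = ℝ ∙ u := by
  refine ⟨(‖v‖⁻¹ : ℝ) • v, norm_smul_inv_norm (𝕜 := ℝ) hv, ?_⟩
  exact (Submodule.span_singleton_smul_eq (IsUnit.mk0 _ (by simpa using hv)) v).symm

/-- An open subgroup `H` of `SO(n)`, together with one reflection, accounts for every product of
hyperplane reflections. -/
theorem exists_mem_prod_reflection_eq {n : ℕ} (hn : 2 ≤ n)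
    {H : Subgroup (Matrix.specialOrthogonalGroup (Fin n) ℝ)}
    (hH : IsOpen (H : Set (Matrix.specialOrthogonalGroup (Fin n) ℝ)))
    {e : EuclideanSpace ℝ (Fin n)} (he : ‖e‖ = 1) (l : List (EuclideanSpace ℝ (Fin n))) :
    ∃ h ∈ H, (∀ x, (l.map fun v => (ℝ ∙ v)ᗮ.reflection).prod x =
        Matrix.toLpLinAlgEquiv 2 (h : Matrix (Fin n) (Fin n) ℝ) x) ∨
      (∀ x, (l.map fun v => (ℝ ∙ v)ᗮ.reflection).prod x =
        Matrix.toLpLinAlgEquiv 2 (reflMatrix e * (h : Matrix (Fin n) (Fin n) ℝ)) x) := by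
  induction l with
  | nil => exact ⟨1, H.one_mem, Or.inl fun x => by simp⟩
  | cons v l ih =>
    obtain ⟨h, hh, ih⟩ := ih
    rcases eq_or_ne v 0 with rfl | hv
    · refine ⟨h, hh, ?_⟩
      have htop : ∀ x : EuclideanSpace ℝ (Fin n),
          (⊤ : Submodule ℝ (EuclideanSpace ℝ (Fin n))).reflection x = x :=
        fun x => Submodule.reflection_mem_subspace_eq_self Submodule.mem_top
      simpa [htop] using ih
    obtain ⟨u, hu, huv⟩ := exists_norm_eq_one_span_eq hv
    rcases ih with ih | ih
    · refine ⟨_, H.mul_mem (reflMatrix_mul_mem_of_isOpen hn hH he hu) hh, Or.inr fun x => ?_⟩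
      have h1 : reflMatrix e * (reflMatrix e * reflMatrix u * (h : Matrix (Fin n) (Fin n) ℝ)) =
          reflMatrix u * (h : Matrix (Fin n) (Fin n) ℝ) := by
        rw [← mul_assoc, ← mul_assoc, reflMatrix_mul_self he, one_mul]
      rw [Submonoid.coe_mul, h1, map_mul, Module.End.mul_apply, ← ih, toLpLin_reflMatrix hu]
      simp [huv]
    · refine ⟨_, H.mul_mem (reflMatrix_mul_mem_of_isOpen hn hH hu he) hh, Or.inl fun x => ?_⟩
      rw [Submonoid.coe_mul, mul_assoc, map_mul, Module.End.mul_apply, ← ih, toLpLin_reflMatrix hu]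
      simp [huv]

/-- `SO(n)` is connected, in the form: it has no proper open subgroup. -/
theorem eq_top_of_isOpen {n : ℕ} (hn : 2 ≤ n)
    {H : Subgroup (Matrix.specialOrthogonalGroup (Fin n) ℝ)}
    (hH : IsOpen (H : Set (Matrix.specialOrthogonalGroup (Fin n) ℝ))) : H = ⊤ := by
  rw [eq_top_iff]
  intro A _
  have hA := Matrix.mem_specialOrthogonalGroup_iff.1 A.2
  have hAA : (A : Matrix (Fin n) (Fin n) ℝ)ᵀ * (A : Matrix (Fin n) (Fin n) ℝ) = 1 :=
    (Matrix.mem_orthogonalGroup_iff' _ _).1 hA.1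
  let L : EuclideanSpace ℝ (Fin n) →ₗᵢ[ℝ] EuclideanSpace ℝ (Fin n) :=
    LinearMap.isometryOfInner (Matrix.toLpLinAlgEquiv 2 (A : Matrix (Fin n) (Fin n) ℝ)) (by
      intro x y
      rw [EuclideanSpace.inner_eq_star_dotProduct, EuclideanSpace.inner_eq_star_dotProduct]
      change ((A : Matrix (Fin n) (Fin n) ℝ) *ᵥ y.ofLp) ⬝ᵥ
        ((A : Matrix (Fin n) (Fin n) ℝ) *ᵥ x.ofLp) = y.ofLp ⬝ᵥ x.ofLp
      rw [Matrix.dotProduct_mulVec, Matrix.vecMul_mulVec, hAA, Matrix.vecMul_one])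
  obtain ⟨l, -, hl⟩ := (L.toLinearIsometryEquiv rfl).reflections_generate_dim
  have hlx : ∀ x, (l.map fun v => (ℝ ∙ v)ᗮ.reflection).prod x =
      Matrix.toLpLinAlgEquiv 2 (A : Matrix (Fin n) (Fin n) ℝ) x := fun x => by
    rw [← hl]; rfl
  let e : EuclideanSpace ℝ (Fin n) := EuclideanSpace.single ⟨0, by omega⟩ 1
  have he : ‖e‖ = 1 := by simp [e]
  obtain ⟨h, hh, h1 | h1⟩ := exists_mem_prod_reflection_eq hn hH he l
  · have : A = h := Subtype.ext ((Matrix.toLpLinAlgEquiv 2).injective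
      (LinearMap.ext fun x => (hlx x).symm.trans (h1 x)))
    rwa [this]
  · have h2 : (A : Matrix (Fin n) (Fin n) ℝ) = reflMatrix e * (h : Matrix (Fin n) (Fin n) ℝ) :=
      (Matrix.toLpLinAlgEquiv 2).injective (LinearMap.ext fun x => (hlx x).symm.trans (h1 x))
    have h3 := congrArg Matrix.det h2
    rw [Matrix.det_mul, det_reflMatrix he, hA.2,
      (Matrix.mem_specialOrthogonalGroup_iff.1 h.2).2] at h3
    norm_num at h3

/-! ### Subgroups with enough one-parameter groups are open -/

section OperatorNorm

open scoped Matrix.Norms.Operator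

theorem HasStrictFDerivAt.mul_of_eq_one {E 𝔸 : Type*} [NormedAddCommGroup E] [NormedSpace ℝ E]
    [NormedRing 𝔸] [NormedAlgebra ℝ 𝔸] {f g : E → 𝔸} {f' g' : E →L[ℝ] 𝔸} {x : E}
    (hf : HasStrictFDerivAt f f' x) (hg : HasStrictFDerivAt g g' x) (hf1 : f x = 1)
    (hg1 : g x = 1) : HasStrictFDerivAt (fun y => f y * g y) (f' + g') x := by
  have h := hf.mul' hg
  rw [hf1, hg1] at h
  convert! h using 1
  ext y
  change f' y + g' y = 1 * g' y + f' y * 1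
  rw [one_mul, mul_one, add_comm]

/-- The generators of the one-parameter groups `t ↦ exp (t • X)` that stay in the subgroup `Γ`.
For a closed `Γ` this is its Lie algebra; in general it need not be a subspace. -/
def expGenerators {n : ℕ} (Γ : Subgroup (Matrix.specialOrthogonalGroup (Fin n) ℝ)) :
    Set (Matrix (Fin n) (Fin n) ℝ) :=
  {X | ∀ t : ℝ, ∃ g ∈ Γ, (g : Matrix (Fin n) (Fin n) ℝ) = NormedSpace.exp (t • X)}

/-- Multiplying one-parameter groups in `Γ` parametrizes part of `Γ` by a map that is strictly
differentiable at `0` and whose derivative there has any prescribed finite set of generators in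
its range. -/
theorem exists_hasStrictFDerivAt_of_finset {n : ℕ}
    {Γ : Subgroup (Matrix.specialOrthogonalGroup (Fin n) ℝ)}
    (s : Finset (Matrix (Fin n) (Fin n) ℝ)) (hs : ↑s ⊆ expGenerators Γ) :
    ∃ (E : Type) (_ : NormedAddCommGroup E) (_ : NormedSpace ℝ E) (_ : CompleteSpace E)
      (f : E → Matrix (Fin n) (Fin n) ℝ) (f' : E →L[ℝ] Matrix (Fin n) (Fin n) ℝ),
      HasStrictFDerivAt f f' 0 ∧ f 0 = 1 ∧
      (∀ x, ∃ g ∈ Γ, (g : Matrix (Fin n) (Fin n) ℝ) = f x) ∧ ∀ X ∈ s, ∃ x, f' x = X := by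
  classical
  induction s using Finset.induction_on with
  | empty =>
    exact ⟨ℝ, inferInstance, inferInstance, inferInstance, fun _ => 1, 0,
      hasStrictFDerivAt_const _ _, rfl, fun _ => ⟨1, Γ.one_mem, rfl⟩, by simp⟩
  | insert X s _ ih =>
    obtain ⟨E, _, _, _, f, f', hf, hf0, hfΓ, hfs⟩ :=
      ih fun Y hY => hs (Finset.mem_coe.2 (Finset.mem_insert_of_mem hY))
    have hX : X ∈ expGenerators Γ := hs (Finset.mem_coe.2 (Finset.mem_insert_self X s))
    have h1 : HasStrictFDerivAt (fun p : E × ℝ => f p.1)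
        (f'.comp (ContinuousLinearMap.fst ℝ E ℝ)) 0 :=
      HasStrictFDerivAt.comp (0 : E × ℝ) hf hasStrictFDerivAt_fst
    have h2 : HasStrictFDerivAt (fun p : E × ℝ => NormedSpace.exp (p.2 • X))
        ((ContinuousLinearMap.toSpanSingleton ℝ X).comp (ContinuousLinearMap.snd ℝ E ℝ)) 0 := by
      have h := hasStrictDerivAt_exp_smul_const X (0 : ℝ)
      rw [zero_smul, NormedSpace.exp_zero, one_mul] at h
      exact HasStrictFDerivAt.comp (g := fun t : ℝ => NormedSpace.exp (t • X)) (0 : E × ℝ)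
        h.hasStrictFDerivAt hasStrictFDerivAt_snd
    refine ⟨E × ℝ, inferInstance, inferInstance, inferInstance,
      fun p => f p.1 * NormedSpace.exp (p.2 • X), _, h1.mul_of_eq_one h2 hf0 (by simp),
      by simp [hf0], ?_, ?_⟩
    · rintro ⟨x, t⟩
      obtain ⟨g, hg, hgx⟩ := hfΓ x
      obtain ⟨g', hg', hgt⟩ := hX t
      exact ⟨g * g', Γ.mul_mem hg hg', by rw [Submonoid.coe_mul, hgx, hgt]⟩
    · intro Y hY
      rcases Finset.mem_insert.1 hY with rfl | hY
      · refine ⟨(0, 1), ?_⟩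
        change f' 0 + (1 : ℝ) • Y = Y
        rw [map_zero, one_smul, zero_add]
      · obtain ⟨x, hx⟩ := hfs Y hY
        refine ⟨(x, 0), ?_⟩
        change f' x + (0 : ℝ) • X = Y
        rw [hx, zero_smul, add_zero]

/-- An orthogonal matrix `1 + T` with `T` symmetric and `2 + T` invertible is the identity. -/
theorem eq_zero_of_one_add_orthogonal {n : ℕ} {T : Matrix (Fin n) (Fin n) ℝ} (hT : Tᵀ = T)
    (hu : IsUnit (2 + T)) (ho : (1 + T) * (1 + T)ᵀ = 1) : T = 0 := by
  have h : (2 + T) * T = 0 := by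
    rw [Matrix.transpose_add, Matrix.transpose_one, hT] at ho
    have h1 : (1 + T) * (1 + T) = 1 + (2 + T) * T := by noncomm_ring
    rw [h1] at ho
    simpa using ho
  simpa using hu.mul_left_cancel (h.trans (mul_zero _).symm)

/-- A subgroup of `SO(n)` whose one-parameter groups have generators spanning the skew-symmetric
matrices is all of `SO(n)`. Every matrix near `1` is `g * (1 + T)` with `g ∈ Γ` and `T` a small
symmetric matrix; when it is orthogonal, `T = 0`. So `Γ` is open. -/
theorem eq_top_of_skew_le_span {n : ℕ} (hn : 2 ≤ n)
    {Γ : Subgroup (Matrix.specialOrthogonalGroup (Fin n) ℝ)}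
    (hΓ : ∀ X : Matrix (Fin n) (Fin n) ℝ, Xᵀ = -X → X ∈ Submodule.span ℝ (expGenerators Γ)) :
    Γ = ⊤ := by
  refine eq_top_of_isOpen hn (Subgroup.isOpen_of_mem_nhds Γ (g := 1) ?_)
  obtain ⟨s, hs, hspan⟩ := (Submodule.fg_span_iff_fg_span_finset_subset (expGenerators Γ)).1
    (IsNoetherian.noetherian (Submodule.span ℝ (expGenerators Γ)))
  obtain ⟨E, _, _, _, f, f', hf, hf0, hfΓ, hfs⟩ := exists_hasStrictFDerivAt_of_finset s hs
  have hrange : ∀ X : Matrix (Fin n) (Fin n) ℝ, Xᵀ = -X → ∃ x, f' x = X := by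
    intro X hX
    have h := hΓ X hX
    rw [hspan] at h
    have hle : Submodule.span ℝ (s : Set (Matrix (Fin n) (Fin n) ℝ)) ≤ f'.toLinearMap.range :=
      Submodule.span_le.2 fun Y hY => hfs Y hY
    exact hle h
  let sym : Matrix (Fin n) (Fin n) ℝ →L[ℝ] Matrix (Fin n) (Fin n) ℝ :=
    LinearMap.toContinuousLinearMap
      (LinearMap.id + (Matrix.transposeLinearEquiv (Fin n) (Fin n) ℝ ℝ).toLinearMap)
  have hsym : ∀ S, sym S = S + Sᵀ := fun S => rfl
  have h1 : HasStrictFDerivAt (fun p : E × Matrix (Fin n) (Fin n) ℝ => f p.1)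
      (f'.comp (ContinuousLinearMap.fst ℝ E _)) 0 :=
    HasStrictFDerivAt.comp (0 : E × Matrix (Fin n) (Fin n) ℝ) hf hasStrictFDerivAt_fst
  have h2 : HasStrictFDerivAt (fun p : E × Matrix (Fin n) (Fin n) ℝ => 1 + sym p.2)
      (sym.comp (ContinuousLinearMap.snd ℝ E _)) 0 :=
    (sym.comp (ContinuousLinearMap.snd ℝ E _)).hasStrictFDerivAt.const_add 1
  have hnhds : Filter.map (fun p : E × Matrix (Fin n) (Fin n) ℝ => f p.1 * (1 + sym p.2))
      (nhds 0) = nhds (1 : Matrix (Fin n) (Fin n) ℝ) := by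
    have h0 : f (0 : E × Matrix (Fin n) (Fin n) ℝ).1 *
        (1 + sym (0 : E × Matrix (Fin n) (Fin n) ℝ).2) = 1 := by simp [hf0]
    refine ((h1.mul_of_eq_one h2 hf0 (by simp)).map_nhds_eq_of_surj ?_).trans (congrArg nhds h0)
    rw [LinearMap.range_eq_top]
    intro A
    obtain ⟨x, hx⟩ := hrange ((1 / 2 : ℝ) • (A - Aᵀ)) (by simp [smul_sub])
    -- `f'` supplies the skew part of `A`; the symmetric part is `S + Sᵀ` for `S = (A + Aᵀ) / 4`.
    refine ⟨(x, (1 / 4 : ℝ) • (A + Aᵀ)), ?_⟩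
    change f' x + sym ((1 / 4 : ℝ) • (A + Aᵀ)) = A
    rw [hx, hsym, Matrix.transpose_smul, Matrix.transpose_add, Matrix.transpose_transpose]
    module
  have hev : ∀ᶠ p : E × Matrix (Fin n) (Fin n) ℝ in nhds 0, IsUnit (2 + sym p.2) := by
    have hc : ContinuousAt (fun p : E × Matrix (Fin n) (Fin n) ℝ => 2 + sym p.2) 0 := by fun_prop
    have h2u : IsUnit (2 : Matrix (Fin n) (Fin n) ℝ) := by
      have := (IsUnit.mk0 (2 : ℝ) two_ne_zero).map (algebraMap ℝ (Matrix (Fin n) (Fin n) ℝ))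
      rwa [map_ofNat] at this
    exact hc.eventually (Units.isOpen.mem_nhds (by simpa using h2u))
  have hmem : ∀ᶠ A in nhds (1 : Matrix (Fin n) (Fin n) ℝ),
      ∃ p : E × Matrix (Fin n) (Fin n) ℝ, f p.1 * (1 + sym p.2) = A ∧ IsUnit (2 + sym p.2) := by
    rw [← hnhds, Filter.eventually_map]
    exact hev.mono fun p hp => ⟨p, rfl, hp⟩
  have hcoe : ContinuousAt ((↑) : Matrix.specialOrthogonalGroup (Fin n) ℝ →
      Matrix (Fin n) (Fin n) ℝ) 1 := continuous_subtype_val.continuousAt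
  refine Filter.mem_of_superset (hcoe.eventually hmem) ?_
  rintro A ⟨⟨x, S⟩, hA, hu⟩
  obtain ⟨g, hg, hgx⟩ := hfΓ x
  have hq : 1 + sym S = ((g⁻¹ * A : Matrix.specialOrthogonalGroup (Fin n) ℝ) :
      Matrix (Fin n) (Fin n) ℝ) := by
    have h3 : ((g⁻¹ * g : Matrix.specialOrthogonalGroup (Fin n) ℝ) :
      Matrix (Fin n) (Fin n) ℝ) = 1 := by rw [inv_mul_cancel]; rfl
    rw [Submonoid.coe_mul] at h3 ⊢
    rw [← hA, ← hgx, ← mul_assoc, h3, one_mul]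
  have hS : sym S = 0 := by
    refine eq_zero_of_one_add_orthogonal (by simp [hsym, add_comm]) hu ?_
    rw [hq]
    exact (Matrix.mem_orthogonalGroup_iff _ _).1 (Matrix.mem_specialOrthogonalGroup_iff.1
      (g⁻¹ * A).2).1
  have hAg : A = g := Subtype.ext (by rw [← hA, hgx]; simp [hS])
  rw [hAg]
  exact hg

/-! ### The Lie algebra spanned by the one-parameter groups of a subgroup -/

theorem mem_of_hasDerivAt {E : Type*} [NormedAddCommGroup E] [NormedSpace ℝ E]
    [FiniteDimensional ℝ E] {W : Submodule ℝ E} {f : ℝ → E} {f' : E} {a : ℝ}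
    (hf : HasDerivAt f f' a) (hW : ∀ t, f t ∈ W) : f' ∈ W := by
  refine W.closed_of_finiteDimensional.mem_of_tendsto (hasDerivAt_iff_tendsto_slope_zero.1 hf)
    (Filter.Eventually.of_forall fun t => ?_)
  exact W.smul_mem _ (W.sub_mem (hW _) (hW _))

theorem exp_smul_mul_exp_smul_neg {n : ℕ} (X : Matrix (Fin n) (Fin n) ℝ) (t : ℝ) :
    NormedSpace.exp (t • X) * NormedSpace.exp (t • -X) = 1 := by
  rw [smul_neg, ← Matrix.exp_add_of_commute _ _ (Commute.refl (t • X)).neg_right]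
  simp

theorem transpose_eq_neg_of_mem_expGenerators {n : ℕ}
    {Γ : Subgroup (Matrix.specialOrthogonalGroup (Fin n) ℝ)} {X : Matrix (Fin n) (Fin n) ℝ}
    (hX : X ∈ expGenerators Γ) : Xᵀ = -X := by
  have h : ∀ t : ℝ, NormedSpace.exp (t • Xᵀ) = NormedSpace.exp (t • -X) := by
    intro t
    obtain ⟨g, -, hg⟩ := hX t
    have hgg := (Matrix.mem_orthogonalGroup_iff' _ _).1
      (Matrix.mem_specialOrthogonalGroup_iff.1 g.2).1
    rw [hg, ← Matrix.exp_transpose, Matrix.transpose_smul] at hgg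
    exact left_inv_eq_right_inv hgg (exp_smul_mul_exp_smul_neg X t)
  have h1 := hasDerivAt_exp_smul_const Xᵀ (0 : ℝ)
  have h2 := hasDerivAt_exp_smul_const (-X) (0 : ℝ)
  simpa using h1.unique (h2.congr_of_eventuallyEq (Filter.Eventually.of_forall h))

theorem conj_mem_expGenerators {n : ℕ}
    {Γ : Subgroup (Matrix.specialOrthogonalGroup (Fin n) ℝ)} {U V : Matrix (Fin n) (Fin n) ℝ}
    (hUV : U * V = 1)
    (hU : ∀ h ∈ Γ, ∃ h' ∈ Γ, (h' : Matrix (Fin n) (Fin n) ℝ) = U * (h : Matrix _ _ ℝ) * V)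
    {X : Matrix (Fin n) (Fin n) ℝ} (hX : X ∈ expGenerators Γ) :
    U * X * V ∈ expGenerators Γ := by
  intro t
  obtain ⟨g, hg, hgt⟩ := hX t
  obtain ⟨g', hg', hgg'⟩ := hU g hg
  refine ⟨g', hg', ?_⟩
  have hu : IsUnit U := isUnit_of_mul_isUnit_left (hUV ▸ isUnit_one)
  rw [hgg', hgt, ← Matrix.inv_eq_right_inv hUV, ← Matrix.exp_conj U _ hu]
  simp

theorem conj_mem_span_expGenerators {n : ℕ}
    {Γ : Subgroup (Matrix.specialOrthogonalGroup (Fin n) ℝ)} {U V : Matrix (Fin n) (Fin n) ℝ}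
    (hUV : U * V = 1)
    (hU : ∀ h ∈ Γ, ∃ h' ∈ Γ, (h' : Matrix (Fin n) (Fin n) ℝ) = U * (h : Matrix _ _ ℝ) * V)
    {X : Matrix (Fin n) (Fin n) ℝ} (hX : X ∈ Submodule.span ℝ (expGenerators Γ)) :
    U * X * V ∈ Submodule.span ℝ (expGenerators Γ) := by
  induction hX using Submodule.span_induction with
  | mem X hX => exact Submodule.subset_span (conj_mem_expGenerators hUV hU hX)
  | zero => simp
  | add X Y _ _ hX hY => rw [mul_add, add_mul]; exact Submodule.add_mem _ hX hY
  | smul c X _ hX => rw [Matrix.mul_smul, Matrix.smul_mul]; exact Submodule.smul_mem _ c hX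

/-- The span of the generators is a Lie algebra: it is stable under conjugation by `exp (t • X)`,
hence under the derivative of this conjugation at `t = 0`. -/
theorem commutator_mem_span_expGenerators {n : ℕ}
    {Γ : Subgroup (Matrix.specialOrthogonalGroup (Fin n) ℝ)} {X Y : Matrix (Fin n) (Fin n) ℝ}
    (hX : X ∈ Submodule.span ℝ (expGenerators Γ)) (hY : Y ∈ Submodule.span ℝ (expGenerators Γ)) :
    X * Y - Y * X ∈ Submodule.span ℝ (expGenerators Γ) := by
  induction hX using Submodule.span_induction with
  | mem X hX =>
    have hd : HasDerivAt
        (fun t : ℝ => NormedSpace.exp (t • X) * Y * NormedSpace.exp (t • -X)) (X * Y - Y * X) 0 := by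
      have h := ((hasDerivAt_exp_smul_const X (0 : ℝ)).mul_const Y).mul
        (hasDerivAt_exp_smul_const (-X) (0 : ℝ))
      convert! h using 1
      simp [sub_eq_add_neg]
    refine mem_of_hasDerivAt hd fun t => conj_mem_span_expGenerators
      (exp_smul_mul_exp_smul_neg X t) (fun h hh => ?_) hY
    obtain ⟨g, hg, hgt⟩ := hX t
    have hinv : ((g⁻¹ : Matrix.specialOrthogonalGroup (Fin n) ℝ) : Matrix (Fin n) (Fin n) ℝ) =
        NormedSpace.exp (t • -X) := by
      have h1 : ((g⁻¹ * g : Matrix.specialOrthogonalGroup (Fin n) ℝ) :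
        Matrix (Fin n) (Fin n) ℝ) = 1 := by rw [inv_mul_cancel]; rfl
      rw [Submonoid.coe_mul, hgt] at h1
      exact left_inv_eq_right_inv h1 (exp_smul_mul_exp_smul_neg X t)
    exact ⟨g * h * g⁻¹, Γ.mul_mem (Γ.mul_mem hg hh) (Γ.inv_mem hg), by
      rw [Submonoid.coe_mul, Submonoid.coe_mul, hgt, hinv]⟩
  | zero => simp
  | add X X' _ _ h h' =>
    rw [show (X + X') * Y - Y * (X + X') = (X * Y - Y * X) + (X' * Y - Y * X') by noncomm_ring]
    exact Submodule.add_mem _ h h'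
  | smul c X _ h =>
    rw [Matrix.smul_mul, Matrix.mul_smul, ← smul_sub]
    exact Submodule.smul_mem _ c h

/-! ### One-parameter groups in the image of a representation -/

theorem exp_mem_specialOrthogonalGroup {n : ℕ} {X : Matrix (Fin n) (Fin n) ℝ} (hX : Xᵀ = -X) :
    NormedSpace.exp X ∈ Matrix.specialOrthogonalGroup (Fin n) ℝ := by
  have horth : ∀ Y : Matrix (Fin n) (Fin n) ℝ, Yᵀ = -Y →
      NormedSpace.exp Y * (NormedSpace.exp Y)ᵀ = 1 := by
    intro Y hY
    have h := exp_smul_mul_exp_smul_neg Y 1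
    rwa [one_smul, one_smul, ← hY, Matrix.exp_transpose] at h
  rw [Matrix.mem_specialOrthogonalGroup_iff, Matrix.mem_orthogonalGroup_iff]
  refine ⟨horth X hX, ?_⟩
  -- The determinant is the square of that of `exp (X / 2)`, which is `±1`.
  have hhalf : NormedSpace.exp X =
      NormedSpace.exp ((1 / 2 : ℝ) • X) * NormedSpace.exp ((1 / 2 : ℝ) • X) := by
    rw [← Matrix.exp_add_of_commute _ _ (Commute.refl _)]
    congr 1
    module
  have h := congrArg Matrix.det (horth ((1 / 2 : ℝ) • X) (by
    rw [Matrix.transpose_smul, hX, smul_neg]))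
  rw [Matrix.det_mul, Matrix.det_transpose, Matrix.det_one] at h
  rw [hhalf, Matrix.det_mul, h]

theorem exp_smul_mulVec_one {n : ℕ} {X : Matrix (Fin n) (Fin n) ℝ} (hX : X *ᵥ 1 = 0) (t : ℝ) :
    NormedSpace.exp (t • X) *ᵥ 1 = 1 := by
  set J : Matrix (Fin n) (Fin n) ℝ := Matrix.of fun _ _ => 1 with hJ
  have hcol : ∀ (A : Matrix (Fin n) (Fin n) ℝ) (i j : Fin n), (A * J) i j = (A *ᵥ 1) i := by
    intro A i j
    simp [Matrix.mul_apply, Matrix.mulVec, dotProduct, hJ]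
  have hXJ : X * J = 0 := by
    ext i j
    rw [hcol, hX]
    rfl
  have hd : ∀ s : ℝ, HasDerivAt (fun s : ℝ => NormedSpace.exp (s • X) * J) 0 s := by
    intro s
    have h := (hasDerivAt_exp_smul_const X s).mul_const J
    rwa [mul_assoc, hXJ, mul_zero] at h
  have hconst := is_const_of_deriv_eq_zero (fun s => (hd s).differentiableAt)
    (fun s => (hd s).deriv) t 0
  rw [zero_smul, NormedSpace.exp_zero, one_mul] at hconst
  ext i
  rw [← hcol _ i i, hconst]
  rfl

/-- A continuous homomorphism `SO(k) → SO(N)` maps one-parameter groups to one-parameter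
groups. -/
theorem exists_map_exp_eq_exp {k N : ℕ}
    {φ : Matrix.specialOrthogonalGroup (Fin k) ℝ →* Matrix.specialOrthogonalGroup (Fin N) ℝ}
    (hφ : Continuous φ) {Y : Matrix (Fin k) (Fin k) ℝ} (hY : Yᵀ = -Y) :
    ∃ (c : ℝ → Matrix.specialOrthogonalGroup (Fin k) ℝ) (X : Matrix (Fin N) (Fin N) ℝ), ∀ t,
      (c t : Matrix (Fin k) (Fin k) ℝ) = NormedSpace.exp (t • Y) ∧
      (φ (c t) : Matrix (Fin N) (Fin N) ℝ) = NormedSpace.exp (t • X) := by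
  let c : ℝ → Matrix.specialOrthogonalGroup (Fin k) ℝ := fun t =>
    ⟨NormedSpace.exp (t • Y), exp_mem_specialOrthogonalGroup (by
      rw [Matrix.transpose_smul, hY, smul_neg])⟩
  have hc : Continuous c := by
    refine Continuous.subtype_mk ?_ _
    exact continuous_iff_continuousAt.2 fun t => (hasDerivAt_exp_smul_const Y t).continuousAt
  have hadd : ∀ s t, c (s + t) = c s * c t := fun s t => Subtype.ext (by
    change NormedSpace.exp ((s + t) • Y) = NormedSpace.exp (s • Y) * NormedSpace.exp (t • Y)
    rw [add_smul, Matrix.exp_add_of_commute]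
    exact ((Commute.refl Y).smul_left s).smul_right t)
  have h0 : c 0 = 1 := Subtype.ext (by
    change NormedSpace.exp ((0 : ℝ) • Y) = 1
    rw [zero_smul, NormedSpace.exp_zero])
  obtain ⟨X, hX⟩ := exists_eq_exp_smul_of_continuous
    (f := fun t => (φ (c t) : Matrix (Fin N) (Fin N) ℝ))
    (continuous_subtype_val.comp (hφ.comp hc)) (by simp [h0]) (fun s t => by simp [hadd])
  exact ⟨c, X, fun t => ⟨rfl, hX t⟩⟩

/-- If a subgroup of `SO(N)` contains the image of `φ` and all its one-parameter groups fix the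
vector `1`, then so does the image of `φ`, as `SO(k)` is generated by its one-parameter groups. -/
theorem map_mulVec_one_of_forall_expGenerators {k N : ℕ} (hk : 2 ≤ k)
    {φ : Matrix.specialOrthogonalGroup (Fin k) ℝ →* Matrix.specialOrthogonalGroup (Fin N) ℝ}
    (hφ : Continuous φ) {Γ : Subgroup (Matrix.specialOrthogonalGroup (Fin N) ℝ)}
    (hΓ : ∀ g, φ g ∈ Γ) (h : ∀ X ∈ expGenerators Γ, X *ᵥ 1 = 0)
    (g : Matrix.specialOrthogonalGroup (Fin k) ℝ) :
    (φ g : Matrix (Fin N) (Fin N) ℝ) *ᵥ 1 = 1 := by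
  let K : Subgroup (Matrix.specialOrthogonalGroup (Fin k) ℝ) :=
    { carrier := {g | (φ g : Matrix (Fin N) (Fin N) ℝ) *ᵥ 1 = 1}
      mul_mem' := by
        intro a b ha hb
        rw [Set.mem_ofPred_eq] at ha hb ⊢
        rw [map_mul, Submonoid.coe_mul, ← Matrix.mulVec_mulVec, hb, ha]
      one_mem' := by simp
      inv_mem' := by
        intro a ha
        rw [Set.mem_ofPred_eq] at ha ⊢
        conv_lhs => rw [← ha]
        rw [Matrix.mulVec_mulVec, ← Submonoid.coe_mul, ← map_mul, inv_mul_cancel, map_one]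
        simp }
  have hK : K = ⊤ := by
    refine eq_top_of_skew_le_span hk fun Y hY => Submodule.subset_span ?_
    obtain ⟨c, X, hcX⟩ := exists_map_exp_eq_exp hφ hY
    have hX : X ∈ expGenerators Γ := fun t => ⟨_, hΓ (c t), (hcX t).2⟩
    refine fun t => ⟨c t, ?_, (hcX t).1⟩
    change (φ (c t) : Matrix (Fin N) (Fin N) ℝ) *ᵥ 1 = 1
    rw [(hcX t).2]
    exact exp_smul_mulVec_one (h X hX) t
  have hg : g ∈ K := hK ▸ Subgroup.mem_top g
  exact hg

end OperatorNorm

/-! ### Permutation-stable Lie algebras of skew-symmetric matrices -/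

/-- The skew-symmetric matrix `e_i 1ᵀ - 1 e_iᵀ`. -/
def starSkew {ι : Type*} [DecidableEq ι] (i : ι) : Matrix ι ι ℝ :=
  Matrix.of fun a b => (if a = i then 1 else 0) - (if b = i then 1 else 0)

theorem starSkew_submatrix {ι : Type*} [DecidableEq ι] (i : ι) (σ : Equiv.Perm ι) :
    (starSkew (σ i)).submatrix σ σ = starSkew i := by
  ext a b
  simp [starSkew]

theorem starSkew_commutator {ι : Type*} [Fintype ι] [DecidableEq ι] (i j : ι) :
    starSkew i * starSkew j - starSkew j * starSkew i =
      starSkew i - starSkew j -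
        (Fintype.card ι : ℝ) • (Matrix.single i j (1 : ℝ) - Matrix.single j i 1) := by
  have hmul : ∀ i j a b : ι, (starSkew i * starSkew j) a b =
      (if a = i then 1 else 0) - (Fintype.card ι : ℝ) * ((if a = i then 1 else 0) *
        (if b = j then 1 else 0)) - (if i = j then 1 else 0) + (if b = j then 1 else 0) := by
    intro i j a b
    simp only [starSkew, Matrix.mul_apply, Matrix.of_apply, sub_mul, mul_sub,
      Finset.sum_sub_distrib]
    simp [eq_comm (a := j) (b := i)]
    ring
  ext a b
  simp only [Matrix.sub_apply, hmul, Matrix.smul_apply, Matrix.single_apply, smul_eq_mul]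
  simp only [starSkew, Matrix.of_apply, eq_comm (a := i) (b := a), eq_comm (a := j) (b := b),
    eq_comm (a := j) (b := a), eq_comm (a := i) (b := b), eq_comm (a := j) (b := i), ite_and]
  split_ifs <;> ring

/-- Averaging a skew-symmetric matrix with nonzero row sum at `i` over the stabilizer of `i` in
the symmetric group gives a nonzero multiple of `starSkew i`. -/
theorem starSkew_mem_of_mulVec_ne_zero {ι : Type*} [Fintype ι] [DecidableEq ι]
    {W : Submodule ℝ (Matrix ι ι ℝ)}
    (hperm : ∀ X ∈ W, ∀ σ : Equiv.Perm ι, X.submatrix σ σ ∈ W)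
    {X : Matrix ι ι ℝ} (hXW : X ∈ W) (hskew : Xᵀ = -X) {i : ι} (hi : (X *ᵥ 1) i ≠ 0) :
    starSkew i ∈ W := by
  have hX : ∀ a b, X a b = -X b a := fun a b => congrFun (congrFun hskew b) a
  let S : Finset (Equiv.Perm ι) := Finset.univ.filter fun σ => σ i = i
  let Y : Matrix ι ι ℝ := ∑ σ ∈ S, X.submatrix σ σ
  have hYW : Y ∈ W := Submodule.sum_mem _ fun σ _ => hperm X hXW σ
  have hYa : ∀ a b, Y a b = ∑ σ ∈ S, X (σ a) (σ b) := fun a b => by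
    simp [Y, Matrix.sum_apply]
  have hYskew : ∀ a b, Y a b = -Y b a := fun a b => by
    rw [hYa, hYa, ← Finset.sum_neg_distrib]
    exact Finset.sum_congr rfl fun σ _ => hX _ _
  have hYinv : ∀ τ : Equiv.Perm ι, τ i = i → ∀ a b, Y (τ a) (τ b) = Y a b := by
    intro τ hτ a b
    rw [hYa, hYa]
    refine Finset.sum_bij (fun σ _ => σ * τ) (fun σ hσ => ?_) (fun σ _ σ' _ h => mul_right_cancel h)
      (fun σ hσ => ⟨σ * τ⁻¹, ?_, by simp⟩) (fun σ _ => rfl)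
    · simp only [S, Finset.mem_filter, Finset.mem_univ, true_and] at hσ ⊢
      simp [hτ, hσ]
    · simp only [S, Finset.mem_filter, Finset.mem_univ, true_and] at hσ ⊢
      rw [Equiv.Perm.mul_apply, Equiv.Perm.inv_eq_iff_eq.2 hτ.symm, hσ]
  -- Off the row and the column of `i`, a transposition in the stabilizer shows `Y a b = Y b a`.
  have hoff : ∀ a b, a ≠ i → b ≠ i → Y a b = 0 := by
    intro a b ha hb
    have h := hYinv (Equiv.swap a b) (Equiv.swap_apply_of_ne_of_ne ha.symm hb.symm) a b
    rw [Equiv.swap_apply_left, Equiv.swap_apply_right] at h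
    linarith [hYskew a b]
  have hrow : ∀ a b, a ≠ i → b ≠ i → Y i a = Y i b := by
    intro a b ha hb
    have h := hYinv (Equiv.swap a b) (Equiv.swap_apply_of_ne_of_ne ha.symm hb.symm) i b
    rwa [Equiv.swap_apply_of_ne_of_ne ha.symm hb.symm, Equiv.swap_apply_right] at h
  have hdiag : Y i i = 0 := by linarith [hYskew i i]
  have hsum : ∑ b, Y i b ≠ 0 := by
    have h : ∑ b, Y i b = S.card * (X *ᵥ 1) i := by
      simp only [hYa]
      rw [Finset.sum_comm, Finset.card_eq_sum_ones, Nat.cast_sum, Finset.sum_mul]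
      refine Finset.sum_congr rfl fun σ hσ => ?_
      have hσi : σ i = i := (Finset.mem_filter.1 hσ).2
      rw [hσi, Equiv.sum_comp σ (fun b => X i b)]
      simp [Matrix.mulVec, dotProduct]
    rw [h]
    have hS : S.card ≠ 0 := Finset.card_ne_zero.2 ⟨1, by simp [S]⟩
    exact mul_ne_zero (by exact_mod_cast hS) hi
  obtain ⟨b, -, hb⟩ := Finset.exists_ne_zero_of_sum_ne_zero hsum
  have hbi : b ≠ i := fun h => hb (h ▸ hdiag)
  have hYF : starSkew i = (Y i b)⁻¹ • Y := by
    ext c d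
    rw [Matrix.smul_apply, smul_eq_mul, eq_inv_mul_iff_mul_eq₀ hb]
    by_cases hc : c = i <;> by_cases hd : d = i
    · simp [starSkew, hc, hd, hdiag]
    · simp [starSkew, hc, hd, hrow b d hbi hd]
    · subst hd
      rw [hYskew c d, hrow c b hc hbi]
      simp [starSkew, hc]
    · simp [starSkew, hc, hd, hoff c d hc hd]
  rw [hYF]
  exact W.smul_mem _ hYW

/-- A space of matrices that is stable under commutators and under simultaneous permutation of
rows and columns, and contains a skew-symmetric matrix not annihilating the vector `1`, contains
all skew-symmetric matrices. -/
theorem skew_mem_of_commutator_of_perm {ι : Type*} [Fintype ι] [DecidableEq ι]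
    {W : Submodule ℝ (Matrix ι ι ℝ)}
    (hperm : ∀ X ∈ W, ∀ σ : Equiv.Perm ι, X.submatrix σ σ ∈ W)
    (hcomm : ∀ X ∈ W, ∀ Y ∈ W, X * Y - Y * X ∈ W)
    {X : Matrix ι ι ℝ} (hXW : X ∈ W) (hskew : Xᵀ = -X) (hX : X *ᵥ 1 ≠ 0)
    (A : Matrix ι ι ℝ) (hA : Aᵀ = -A) : A ∈ W := by
  obtain ⟨i, hi⟩ := Function.ne_iff.1 hX
  have hcard : (Fintype.card ι : ℝ) ≠ 0 := by
    have : Nonempty ι := ⟨i⟩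
    exact_mod_cast Fintype.card_ne_zero
  have hF : ∀ j, starSkew j ∈ W := by
    intro j
    have h := hperm _ (starSkew_mem_of_mulVec_ne_zero hperm hXW hskew hi) (Equiv.swap i j)
    have h' := starSkew_submatrix j (Equiv.swap i j)
    rw [Equiv.swap_apply_right] at h'
    rwa [h'] at h
  have hE : ∀ a b, Matrix.single a b (1 : ℝ) - Matrix.single b a 1 ∈ W := by
    intro a b
    have h : Matrix.single a b (1 : ℝ) - Matrix.single b a 1 =
        (Fintype.card ι : ℝ)⁻¹ • (starSkew a - starSkew b -
          (starSkew a * starSkew b - starSkew b * starSkew a)) := by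
      rw [starSkew_commutator, sub_sub_cancel, smul_smul, inv_mul_cancel₀ hcard, one_smul]
    rw [h]
    exact W.smul_mem _ (W.sub_mem (W.sub_mem (hF a) (hF b)) (hcomm _ (hF a) _ (hF b)))
  have hsum : A = ∑ a, ∑ b, (A a b / 2) • (Matrix.single a b (1 : ℝ) - Matrix.single b a 1) := by
    have h : A = (1 / 2 : ℝ) • (A - Aᵀ) := by rw [hA]; module
    conv_lhs => rw [h]
    ext c d
    simp [Matrix.sum_apply, Matrix.single_apply, mul_sub, Finset.sum_sub_distrib, ite_and]
    ring
  rw [hsum]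
  exact Submodule.sum_mem _ fun a _ => Submodule.sum_mem _ fun b _ => W.smul_mem _ (hE a b)

/-! ### Conjugation by permutation matrices -/

namespace PermConj

/-- Conjugation by a permutation matrix, as an endomorphism of `SO(N)`. -/
noncomputable def permConjHom {N : ℕ} (σ : Equiv.Perm (Fin N)) :
    Matrix.specialOrthogonalGroup (Fin N) ℝ →* Matrix.specialOrthogonalGroup (Fin N) ℝ :=
  MonoidHom.mk' (permConj σ) fun A B => Subtype.ext (by
    have h : (permO σ)⁻¹ * inclO N (A * B) * permO σ =
        ((permO σ)⁻¹ * inclO N A * permO σ) * ((permO σ)⁻¹ * inclO N B * permO σ) := by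
      rw [map_mul]; group
    have hval := congrArg Subtype.val h
    exact hval)

theorem permO_mul {N : ℕ} (σ τ : Equiv.Perm (Fin N)) : permO (σ * τ) = permO τ * permO σ :=
  Subtype.ext (Matrix.permMatrix_mul σ τ)

theorem permConj_permConj {N : ℕ} (σ τ : Equiv.Perm (Fin N))
    (A : Matrix.specialOrthogonalGroup (Fin N) ℝ) :
    permConj τ (permConj σ A) = permConj (τ * σ) A := by
  have h : (permO τ)⁻¹ * ((permO σ)⁻¹ * inclO N A * permO σ) * permO τ =
      (permO (τ * σ))⁻¹ * inclO N A * permO (τ * σ) := by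
    rw [permO_mul]; group
  have hval := congrArg Subtype.val h
  exact Subtype.ext hval

theorem coe_permConj_inv {N : ℕ} (σ : Equiv.Perm (Fin N))
    (A : Matrix.specialOrthogonalGroup (Fin N) ℝ) :
    (permConj σ⁻¹ A : Matrix (Fin N) (Fin N) ℝ) =
      σ.permMatrix ℝ * (A : Matrix (Fin N) (Fin N) ℝ) * (σ⁻¹).permMatrix ℝ := by
  change ((σ⁻¹).permMatrix ℝ)ᵀ * (A : Matrix (Fin N) (Fin N) ℝ) * (σ⁻¹).permMatrix ℝ = _
  rw [Matrix.transpose_permMatrix, inv_inv]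

theorem permMatrix_mul_mul_permMatrix_inv {N : ℕ} (σ : Equiv.Perm (Fin N))
    (X : Matrix (Fin N) (Fin N) ℝ) :
    σ.permMatrix ℝ * X * (σ⁻¹).permMatrix ℝ = X.submatrix σ σ := by
  rw [PEquiv.toMatrix_toPEquiv_mul, PEquiv.mul_toMatrix_toPEquiv]
  rfl

/-- A subgroup of `SO(N)` that is stable under conjugation by permutation matrices and contains
the image of a representation of `SO(k)` not fixing the vector `1` is all of `SO(N)`. -/
theorem eq_top_of_permConj_mem {k N : ℕ} (hk : 2 ≤ k) (hN : 2 ≤ N)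
    {φ : Matrix.specialOrthogonalGroup (Fin k) ℝ →* Matrix.specialOrthogonalGroup (Fin N) ℝ}
    (hφ : Continuous φ) {Γ : Subgroup (Matrix.specialOrthogonalGroup (Fin N) ℝ)}
    (hΓφ : ∀ g, φ g ∈ Γ) (hΓ : ∀ σ, ∀ A ∈ Γ, permConj σ A ∈ Γ)
    (hone : ∃ g, (φ g : Matrix (Fin N) (Fin N) ℝ) *ᵥ 1 ≠ 1) : Γ = ⊤ := by
  obtain ⟨X, hX, hX1⟩ : ∃ X ∈ expGenerators Γ, X *ᵥ 1 ≠ 0 := by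
    by_contra! h
    obtain ⟨g, hg⟩ := hone
    exact hg (map_mulVec_one_of_forall_expGenerators hk hφ hΓφ h g)
  refine eq_top_of_skew_le_span hN (skew_mem_of_commutator_of_perm (fun Y hY σ => ?_)
    (fun _ hY _ hZ => commutator_mem_span_expGenerators hY hZ) (Submodule.subset_span hX)
    (transpose_eq_neg_of_mem_expGenerators hX) hX1)
  rw [← permMatrix_mul_mul_permMatrix_inv]
  refine conj_mem_span_expGenerators ?_ (fun A hA => ⟨_, hΓ σ⁻¹ A hA, coe_permConj_inv σ A⟩) hY
  rw [← Matrix.permMatrix_mul, inv_mul_cancel, Matrix.permMatrix_one]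

/-- A subgroup of `O(N)` containing `SO(N)` and an element of determinant `-1` is all of
`O(N)`. -/
theorem eq_top_of_inclO_mem {N : ℕ} {K : Subgroup (Matrix.orthogonalGroup (Fin N) ℝ)}
    (hK : ∀ A, inclO N A ∈ K) {E : Matrix.orthogonalGroup (Fin N) ℝ} (hE : E ∈ K)
    (hdet : (E : Matrix (Fin N) (Fin N) ℝ).det = -1) : K = ⊤ := by
  have hSO : ∀ B : Matrix.orthogonalGroup (Fin N) ℝ,
      (B : Matrix (Fin N) (Fin N) ℝ).det = 1 → B ∈ K := fun B hB =>
    hK ⟨B, Matrix.mem_specialOrthogonalGroup_iff.2 ⟨B.2, hB⟩⟩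
  rw [eq_top_iff]
  intro A _
  have hsq : (A : Matrix (Fin N) (Fin N) ℝ).det * (A : Matrix (Fin N) (Fin N) ℝ).det = 1 := by
    have h := congrArg Matrix.det ((Matrix.mem_orthogonalGroup_iff _ _).1 A.2)
    rwa [Matrix.det_mul, Matrix.det_transpose, Matrix.det_one] at h
  rcases mul_self_eq_one_iff.1 hsq with h | h
  · exact hSO A h
  · have hEA : E * A ∈ K := hSO _ (by rw [Submonoid.coe_mul, Matrix.det_mul, hdet, h]; norm_num)
    exact (K.mul_mem_cancel_left hE).1 hEA

end PermConj

theorem theorem2p1 (k N : ℕ) (hk : 3 ≤ k) (hN : 3 ≤ N)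
    (φ : Matrix.specialOrthogonalGroup (Fin k) ℝ →* Matrix.specialOrthogonalGroup (Fin N) ℝ)
    (hφ_cont : Continuous φ)
    (hφ_inv : ∀ V : Submodule ℝ (Fin N → ℝ),
      Module.finrank ℝ V = 1 → ¬ PermConj.IsInvariant φ V) :
    Subgroup.closure
        {A : Matrix.specialOrthogonalGroup (Fin N) ℝ |
          ∃ (σ : Equiv.Perm (Fin N)) (g : Matrix.specialOrthogonalGroup (Fin k) ℝ),
            A = PermConj.permConj σ (φ g)} = ⊤ ∧
    ∀ σ₀ : Equiv.Perm (Fin N), Equiv.Perm.sign σ₀ = -1 →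
      Subgroup.closure
        ({PermConj.permO σ₀} ∪
          {A : Matrix.orthogonalGroup (Fin N) ℝ |
            ∃ (σ : Equiv.Perm (Fin N)) (g : Matrix.specialOrthogonalGroup (Fin k) ℝ),
              A = (PermConj.permO σ)⁻¹ * PermConj.inclO N (φ g) * PermConj.permO σ}) = ⊤ := by
  -- Otherwise the line spanned by `1` would be invariant.
  have hone : ∃ g, (φ g : Matrix (Fin N) (Fin N) ℝ) *ᵥ 1 ≠ 1 := by
    by_contra! h
    have h1 : (1 : Fin N → ℝ) ≠ 0 := fun h0 => one_ne_zero (congrFun h0 ⟨0, by omega⟩)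
    refine hφ_inv (Submodule.span ℝ {1}) (finrank_span_singleton h1) fun g v hv => ?_
    obtain ⟨c, rfl⟩ := Submodule.mem_span_singleton.1 hv
    rw [Matrix.mulVec_smul, h g]
    exact hv
  have hSO : Subgroup.closure
      {A : Matrix.specialOrthogonalGroup (Fin N) ℝ |
        ∃ (σ : Equiv.Perm (Fin N)) (g : Matrix.specialOrthogonalGroup (Fin k) ℝ),
          A = PermConj.permConj σ (φ g)} = ⊤ := by
    refine PermConj.eq_top_of_permConj_mem (by omega) (by omega) hφ_cont (fun g => ?_)
      (fun σ A hA => ?_) hone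
    · refine Subgroup.subset_closure ⟨1, g, Subtype.ext ?_⟩
      have h := PermConj.coe_permConj_inv 1 (φ g)
      simpa using h.symm
    · refine (Subgroup.closure_le ((Subgroup.closure _).comap (PermConj.permConjHom σ))).2 ?_ hA
      rintro _ ⟨τ, g, rfl⟩
      exact Subgroup.subset_closure ⟨σ * τ, g, PermConj.permConj_permConj τ σ (φ g)⟩
  refine ⟨hSO, fun σ₀ hσ₀ => ?_⟩
  refine PermConj.eq_top_of_inclO_mem (E := PermConj.permO σ₀) (fun A => ?_)
    (Subgroup.subset_closure (Or.inl rfl)) ?_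
  · have hA : A ∈ (⊤ : Subgroup (Matrix.specialOrthogonalGroup (Fin N) ℝ)) := Subgroup.mem_top A
    rw [← hSO] at hA
    refine (Subgroup.closure_le ((Subgroup.closure _).comap (PermConj.inclO N))).2 ?_ hA
    rintro _ ⟨σ, g, rfl⟩
    exact Subgroup.subset_closure (Or.inr ⟨σ, g, rfl⟩)
  · change (σ₀.permMatrix ℝ).det = -1
    rw [Matrix.det_permutation, hσ₀]
    simp
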